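/- A (non-uniform) randomized one-pass streaming algorithm with $s$ bits of space is given by a random initial memory content in $\{0,1\}^s$, a randomized transition that maps the current memory content and the next stream item to a new memory content, and a randomized output computed from the final memory content; random choices that are needed again later must be kept in the $s$ bits. For a graph $G$, let $\mathrm{lp}(G)$ be the number of edges of a longest path in $G$; an $\alpha$-approximation to Longest Path is a path of $G$ with at least $\mathrm{lp}(G)/\alpha$ edges. An insertion-only stream describing a simple undirected graph $G$ on the vertex set $[n]$ lists each edge of $G$ once, in arbitrary order. An insertion-deletion stream describing $G$ is a finite sequence of insertions and deletions of single copies of edges such that at every moment the multiplicity of every edge is non-negative and at most $n^{c}$, for a constant $c$, and such that the edges of positive multiplicity at the end are exactly the edges of $G$. Corollary 2. In both the insertion-only and the insertion-deletion model, for undirected graphs and every $\alpha \ge 1$, there are one-pass streaming algorithms with space $\tilde O(n^2/\alpha)$ that compute an $\alpha$-approximation to Longest Path with high probability. Precisely: for every constant $q\in\mathbb N$ (and every constant $c \in \mathbb N$ in the insertion-deletion model) there are constants $C$ and $k$ such that for all integers $n\ge 1$ and all real $\alpha\ge 1$ there is a randomized one-pass streaming algorithm with at most $C\cdot\max\{1,n^2/\alpha\}\cdot(\log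 n)^k$ bits of space which, on every stream of the respective model describing an undirected $n$-vertex graph $G$, outputs with probability at least $1-n^{-q}$ (over its own random choices) a path of $G$ with at least $\mathrm{lp}(G)/\alpha$ edges. (For $\alpha\le n^2$ the maximum is just $n^2/\alpha$.) -/

import Mathlib

open scoped ENNReal

/-- A randomized one-pass streaming algorithm that reads a stream of updates from `U`, keeps
exactly `s` bits of memory, and writes an output in `O` after the end of the stream.
The memory starts in a random state, is updated once per stream item as a random function of its
current content and of that item alone (so random choices that are needed again later have to be
kept in the memory, and there is no free clock), and the output is a random function of the final
memory content. -/
structure StreamAlg (U O : Type) (s : ℕ) where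
  init : PMF (Fin s → Bool)
  step : (Fin s → Bool) → U → PMF (Fin s → Bool)
  out : (Fin s → Bool) → PMF O

namespace StreamAlg

variable {U O : Type} {s : ℕ}

/-- The distribution of the memory content after reading the stream `l`. -/
noncomputable def memory (A : StreamAlg U O s) (l : List U) : PMF (Fin s → Bool) :=
  l.foldl (fun μ u => μ.bind fun m => A.step m u) A.init

/-- The distribution of the output on the stream `l`. -/
noncomputable def run (A : StreamAlg U O s) (l : List U) : PMF O :=
  (A.memory l).bind A.out

/-- The probability, over the random choices of the algorithm, that its output on the stream `l`
lies in `S`. -/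
noncomputable def prob (A : StreamAlg U O s) (l : List U) (S : Set O) : ℝ≥0∞ :=
  (A.run l).toOuterMeasure S

end StreamAlg

/-- The number of edges of a longest path of `G`. -/
noncomputable def longestPathLength {V : Type} (G : SimpleGraph V) : ℕ :=
  sSup {k : ℕ | ∃ (u v : V) (p : G.Walk u v), p.IsPath ∧ p.length = k}

/-- The list of vertices `o` is the vertex sequence of a path of `G` whose length (number of edges)
is at least `longestPathLength G / α`. -/
def IsApproxLongestPath {V : Type} (G : SimpleGraph V) (α : ℝ) (o : List V) : Prop :=
  ∃ (u v : V) (p : G.Walk u v),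
    p.IsPath ∧ p.support = o ∧ (longestPathLength G : ℝ) / α ≤ p.length

/-- An insertion-only stream describing `G`: the edges of `G`, each once, in an arbitrary order. -/
def IsInsertionOnlyStream {n : ℕ} (G : SimpleGraph (Fin n)) (l : List (Sym2 (Fin n))) : Prop :=
  l.Nodup ∧ ∀ e, e ∈ l ↔ e ∈ G.edgeSet

/-- The multiplicity of the edge `e` after the updates `l`, where `(true, e)` inserts one copy
of `e` and `(false, e)` deletes one. -/
def multiplicityAfter {n : ℕ} (l : List (Bool × Sym2 (Fin n))) (e : Sym2 (Fin n)) : ℤ :=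
  (l.count (true, e) : ℤ) - (l.count (false, e) : ℤ)

/-- An insertion-deletion stream describing `G`, with multiplicities bounded by `M`: the updates
concern edges (not loops), at every moment the multiplicity of every edge is between `0` and `M`,
and the edges that survive at the end are exactly the edges of `G`. -/
def IsInsertionDeletionStream {n : ℕ} (M : ℕ) (G : SimpleGraph (Fin n))
    (l : List (Bool × Sym2 (Fin n))) : Prop :=
  (∀ x ∈ l, ¬ x.2.IsDiag) ∧
  (∀ l', l' <+: l → ∀ e, 0 ≤ multiplicityAfter l' e ∧ multiplicityAfter l' e ≤ M) ∧
  (∀ e, e ∈ G.edgeSet ↔ 0 < multiplicityAfter l e)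

/-!
A graph in which every path has at most `ℓ` edges has at most `ℓ * n` edges: all neighbours of the
end of a longest path lie on that path, so some vertex has degree at most `ℓ`
(`ncard_edgeSet_le_of_path_length_le`). Hence any `n ^ 2 / α` edges of `G` contain a path with at least
`n / α ≥ lp(G) / α` edges. It therefore suffices to recover from the stream either all edges of `G` or
at least `T = ⌈n ^ 2 / α⌉` of them.

For insertion-deletion streams this is done by a linear sketch of the multiplicity vector `x`,
taken modulo `n ^ c + 1`. Let `S_0 ⊇ S_1 ⊇ ⋯ ⊇ S_J` be random sets of vertex pairs, `S_0`
containing all of them and each of the others being a uniformly random subset of the one before.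
For every level `j` the sketch stores the sums of `x` over the intersections of `S_j` with `r`
random sets `B_i`. A fixed vector other than the restriction of `x` to `S_j` has the same sums
over the `B_i` as that restriction with probability at most `2⁻ʳ`, so for large `r` no other
`K`-sparse vector explains the sums of level `j`. Decoding returns the support of a `K`-sparse
explanation of the first level that has one. If this is level `0`, then all of `x` is recovered;
otherwise the level before contains more than `K` edges of `G`, and by a Chernoff bound
(`card_filter_card_lt_mul_le`) at least `T` of them survive the next halving, since `K` is a large
enough multiple of `T + log n` (`card_not_isGoodSeed_mul_le`).

The random sets are too large to be stored. But the outcome depends only on the sets and on the final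
vector `x`, which has at most `(n ^ c + 1) ^ (n ^ 2)` possible values, so by the probabilistic method
polynomially many choices of the sets can be fixed in advance such that for every `x` only a fraction
`n⁻ᵠ` of them is bad (`exists_seed_table`). The algorithm draws one of these choices and keeps its
number, of `O(log n)` bits, in the memory.

An insertion-only stream is an insertion-deletion stream with multiplicities at most `1 = n ^ 0`.
-/

/-! ### Graphs with many edges have long paths -/

section Graph

variable {V : Type}

/-- The supremum in `longestPathLength` is attained and is an upper bound, because paths have fewer
edges than the graph has vertices. -/
lemma longestPathLength_spec [Fintype V] [Nonempty V] (H : SimpleGraph V) :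
    (∃ (u v : V) (p : H.Walk u v), p.IsPath ∧ p.length = longestPathLength H) ∧
      ∀ (u v : V) (p : H.Walk u v), p.IsPath → p.length ≤ longestPathLength H := by
  have hb : BddAbove {k : ℕ | ∃ (u v : V) (p : H.Walk u v), p.IsPath ∧ p.length = k} := by
    refine ⟨Fintype.card V, ?_⟩
    rintro _ ⟨u, v, p, hp, rfl⟩
    exact hp.length_lt.le
  refine ⟨Nat.sSup_mem ?_ hb, fun u v p hp => le_csSup hb ⟨u, v, p, hp, rfl⟩⟩
  obtain ⟨v⟩ := ‹Nonempty V›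
  exact ⟨0, v, v, .nil, by simp, rfl⟩

/-- A graph on the vertex set `W` without a path of more than `ℓ` edges has at most `ℓ * #W` edges.
All neighbours of an end vertex of a longest path lie on that path, so such a vertex has degree at
most `ℓ`, and it can be removed. -/
lemma ncard_edgeSet_le_of_path_length_le [Fintype V] (ℓ : ℕ) (W : Finset V) (H : SimpleGraph V)
    (hW : ∀ u v, H.Adj u v → u ∈ W)
    (hℓ : ∀ (u v : V) (p : H.Walk u v), p.IsPath → p.length ≤ ℓ) :
    H.edgeSet.ncard ≤ ℓ * W.card := by
  classical
  induction hk : W.card generalizing W H with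
  | zero =>
    have : H.edgeSet = ∅ := by
      rw [Finset.card_eq_zero] at hk
      ext e
      induction e with | _ u v =>
      simp only [SimpleGraph.mem_edgeSet, Set.mem_empty_iff_false, iff_false]
      intro h
      simpa [hk] using hW u v h
    simp [this]
  | succ k ih =>
    have hne : W.Nonempty := by
      rw [← Finset.card_pos]; omega
    -- a path with the largest length among those that start in `W`
    obtain ⟨v, hv, u, p, hp, hmax⟩ : ∃ v ∈ W, ∃ (u : V) (p : H.Walk v u), p.IsPath ∧
        ∀ w ∈ W, ∀ (u' : V) (p' : H.Walk w u'), p'.IsPath → p'.length ≤ p.length := by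
      have hb : BddAbove {k : ℕ | ∃ v ∈ W, ∃ (u : V) (p : H.Walk v u),
          p.IsPath ∧ p.length = k} := by
        refine ⟨ℓ, ?_⟩
        rintro _ ⟨v, -, u, p, hp, rfl⟩
        exact hℓ _ _ _ hp
      obtain ⟨w, hw⟩ := hne
      have h0 : {k : ℕ | ∃ v ∈ W, ∃ (u : V) (p : H.Walk v u), p.IsPath ∧ p.length = k}.Nonempty :=
        ⟨0, w, hw, w, .nil, by simp, rfl⟩
      obtain ⟨v, hv, u, p, hp, h⟩ := Nat.sSup_mem h0 hb
      exact ⟨v, hv, u, p, hp, fun w hw u' p' hp' => h ▸ le_csSup hb ⟨w, hw, u', p', hp', rfl⟩⟩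
    have hdeg : H.degree v ≤ ℓ := by
      have hsub : H.neighborFinset v ⊆ p.support.toFinset.erase v := by
        intro w hw
        rw [SimpleGraph.mem_neighborFinset] at hw
        refine Finset.mem_erase.2 ⟨hw.ne', List.mem_toFinset.2 ?_⟩
        by_contra hnot
        have := hmax w (hW _ _ hw.symm) u (.cons hw.symm p) (hp.cons hnot)
        simp at this
      refine (Finset.card_le_card hsub).trans ?_
      rw [Finset.card_erase_of_mem (by simp)]
      have := List.toFinset_card_le p.support
      rw [SimpleGraph.Walk.length_support] at this
      have := hℓ _ _ p hp
      omega
    have h1 := ih (W.erase v) (H.deleteIncidenceSet v)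
      (fun a b hab => by
        rw [SimpleGraph.deleteIncidenceSet_adj] at hab
        exact Finset.mem_erase.2 ⟨hab.2.1, hW a b hab.1⟩)
      (fun a b p' hp' => by
        have := hℓ a b (p'.mapLe (H.deleteIncidenceSet_le v)) (hp'.mapLe _)
        simpa using this)
      (by rw [Finset.card_erase_of_mem hv]; omega)
    have h2 : H.edgeSet ⊆ (H.deleteIncidenceSet v).edgeSet ∪ H.incidenceSet v := by
      intro e he
      rw [SimpleGraph.edgeSet_deleteIncidenceSet]
      by_cases h : e ∈ H.incidenceSet v <;> simp [h, he]
    have h3 : (H.incidenceSet v).ncard = H.degree v := by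
      rw [← SimpleGraph.card_incidenceSet_eq_degree, Set.ncard_eq_toFinset_card',
        Set.toFinset_card]
    calc H.edgeSet.ncard ≤ _ := Set.ncard_le_ncard h2 (Set.toFinite _)
      _ ≤ _ := Set.ncard_union_le _ _
      _ ≤ ℓ * k + ℓ := by omega
      _ = ℓ * (k + 1) := by ring

/-- The vertex sequence of some longest path of the graph with edge set `F`. -/
noncomputable def longestPathSupport [Fintype V] [Nonempty V] (F : Set (Sym2 V)) : List V :=
  (longestPathLength_spec (SimpleGraph.fromEdgeSet F)).1.choose_spec.choose_spec.choose.support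

/-- It suffices to know all edges of `G`, or any `n ^ 2 / α` of them: the latter contain a path with
`n / α` edges, and no path of `G` has more than `n` edges. -/
lemma isApproxLongestPath_longestPathSupport [Fintype V] [Nonempty V] (G : SimpleGraph V) {α : ℝ}
    (hα : 1 ≤ α) {F : Set (Sym2 V)} (hF : F ⊆ G.edgeSet)
    (h : F = G.edgeSet ∨ (Fintype.card V : ℝ) ^ 2 / α ≤ F.ncard) :
    IsApproxLongestPath G α (longestPathSupport F) := by
  classical
  set H := SimpleGraph.fromEdgeSet F with hH
  have hHF : H.edgeSet = F := by
    rw [hH, SimpleGraph.edgeSet_fromEdgeSet]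
    ext e
    simp only [Set.mem_sdiff, and_iff_left_iff_imp]
    exact fun he => G.not_isDiag_of_mem_edgeSet (hF he)
  have hle : H ≤ G := by
    rw [← SimpleGraph.edgeSet_subset_edgeSet, hHF]; exact hF
  obtain ⟨hp, hlen⟩ :=
    (longestPathLength_spec (SimpleGraph.fromEdgeSet F)).1.choose_spec.choose_spec.choose_spec
  refine ⟨_, _, (longestPathLength_spec
    (SimpleGraph.fromEdgeSet F)).1.choose_spec.choose_spec.choose.mapLe hle, hp.mapLe hle, ?_, ?_⟩
  · simp [longestPathSupport]
  · rw [SimpleGraph.Walk.length_mapLe, hlen]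
    have hα0 : 0 < α := by linarith
    rcases h with h | h
    · have : H = G := by
        rw [← SimpleGraph.edgeSet_inj, hHF, h]
      rw [← hH, this]
      exact div_le_self (by positivity) hα
    · have h1 := ncard_edgeSet_le_of_path_length_le (longestPathLength H) Finset.univ H
        (by simp) (longestPathLength_spec H).2
      rw [hHF, Finset.card_univ] at h1
      have hV : (0 : ℝ) < Fintype.card V := by exact_mod_cast Fintype.card_pos
      have h2 : (longestPathLength G : ℝ) ≤ Fintype.card V := by
        obtain ⟨u, v, p, hp, h⟩ := (longestPathLength_spec G).1
        rw [← h]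
        exact_mod_cast hp.length_lt.le
      have h3 : (F.ncard : ℝ) ≤ longestPathLength H * Fintype.card V := by exact_mod_cast h1
      rw [← hH, div_le_iff₀ hα0]
      rw [div_le_iff₀ hα0] at h
      have h4 : (Fintype.card V : ℝ) * Fintype.card V
          ≤ (longestPathLength H * α) * Fintype.card V := by nlinarith
      exact h2.trans (le_of_mul_le_mul_right h4 hV)

end Graph

/-! ### Counting bad random choices -/

section Counting

open Finset

/-- The sum of a nonzero vector over a random set of coordinates vanishes with probability at most
`1 / 2`: toggling the membership of one fixed coordinate in the support changes the sum. -/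
lemma two_mul_card_filter_sum_eq_zero_le {E A : Type} [Fintype E] [DecidableEq E] [AddCommGroup A]
    [DecidableEq A] {z : E → A} (hz : z ≠ 0) :
    #{b : E → Bool | ∑ e, (if b e then z e else 0) = 0} * 2 ≤ Fintype.card (E → Bool) := by
  obtain ⟨e₀, he₀⟩ := Function.ne_iff.1 hz
  have hsum (b : E → Bool) : ∑ e, (if b e then z e else 0) =
      (if b e₀ then z e₀ else 0) + ∑ e ∈ univ.erase e₀, (if b e then z e else 0) :=
    (add_sum_erase _ _ (mem_univ _)).symm
  have key : #{b : E → Bool | ∑ e, (if b e then z e else 0) = 0} ≤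
      #{b : E → Bool | ¬ ∑ e, (if b e then z e else 0) = 0} := by
    refine card_le_card_of_injOn (fun b => Function.update b e₀ (!b e₀)) ?_ ?_
    · intro b hb
      simp only [coe_filter, mem_univ, true_and, Set.mem_ofPred_eq] at hb ⊢
      have hrest : ∑ e ∈ univ.erase e₀, (if Function.update b e₀ (!b e₀) e then z e else 0) =
          ∑ e ∈ univ.erase e₀, (if b e then z e else 0) :=
        sum_congr rfl fun e he => by rw [Function.update_of_ne (ne_of_mem_erase he)]
      rw [hsum] at hb
      rw [hsum, hrest, Function.update_self]
      have he₀' : z e₀ ≠ 0 := he₀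
      intro h
      cases hb0 : b e₀ <;> simp_all
    · intro b _ b' _ h
      have h' : ∀ c : E → Bool, Function.update (Function.update c e₀ (!c e₀)) e₀
          (!(Function.update c e₀ (!c e₀)) e₀) = c := by
        intro c; simp
      have h2 : Function.update b e₀ (!b e₀) = Function.update b' e₀ (!b' e₀) := h
      rw [← h' b, h2, h' b']
  have := card_filter_add_card_filter_not (s := (univ : Finset (E → Bool)))
    (fun b => ∑ e, (if b e then z e else 0) = 0)
  rw [card_univ] at this
  omega

lemma card_filter_forall {X : Type} [Fintype X] (P : X → Prop) [DecidablePred P] (r : ℕ) :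
    #{f : Fin r → X | ∀ i, P (f i)} = #{x | P x} ^ r := by
  classical
  rw [← Fintype.card_piFinset_const]
  congr 1
  ext f
  simp

lemma card_filter_forall_mul_le {X : Type} [Fintype X] (P : X → Prop) [DecidablePred P] (r : ℕ)
    (h : #{x | P x} * 2 ≤ Fintype.card X) :
    #{f : Fin r → X | ∀ i, P (f i)} * 2 ^ r ≤ Fintype.card (Fin r → X) := by
  rw [card_filter_forall, ← mul_pow, Fintype.card_fun, Fintype.card_fin]
  exact Nat.pow_le_pow_left h r

/-- A Chernoff bound: a random subset of a set with at least `3 * (T + a)` elements has fewer than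
`T` elements with probability at most `2⁻ᵃ`. -/
lemma card_filter_card_lt_mul_le {E : Type} [Fintype E] [DecidableEq E] (S : Finset E) (T a : ℕ)
    (h : 3 * (T + a) ≤ #S) :
    #{b : E → Bool | #{e ∈ S | b e} < T} * 2 ^ a ≤ Fintype.card (E → Bool) := by
  -- the exponential moment of the number of rejected elements
  have hsum : ∑ b : E → Bool, 2 ^ #{e ∈ S | ¬ b e} = 3 ^ #S * 2 ^ (Fintype.card E - #S) := by
    have h1 : ∀ b : E → Bool, 2 ^ #{e ∈ S | ¬ b e} =
        ∏ e, (if e ∈ S ∧ ¬ b e then 2 else 1) := by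
      intro b
      rw [prod_ite, prod_const, prod_const_one, mul_one]
      congr 2
      ext e
      simp
    simp_rw [h1]
    have h2 := Fintype.prod_sum (fun (e : E) (c : Bool) => if e ∈ S ∧ ¬ c then 2 else 1)
    rw [← h2]
    have h3 : ∀ e : E, ∑ c : Bool, (if e ∈ S ∧ ¬ c then 2 else 1) = if e ∈ S then 3 else 2 := by
      intro e
      by_cases he : e ∈ S <;> simp [he]
    simp_rw [h3]
    rw [prod_ite, prod_const, prod_const]
    congr 2
    · simp
    · rw [← card_univ, ← card_sdiff_of_subset (subset_univ S)]
      congr 1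
      ext e
      simp
  set bad := ({b : E → Bool | #{e ∈ S | b e} < T} : Finset (E → Bool)) with hbad
  have hmarkov : #bad * 2 ^ #S ≤ 2 ^ T * (3 ^ #S * 2 ^ (Fintype.card E - #S)) := by
    rw [← hsum, mul_sum, ← smul_eq_mul, ← sum_const]
    refine (sum_le_sum fun b hb => ?_).trans
      (sum_le_univ_sum_of_nonneg fun _ => Nat.zero_le _)
    rw [← pow_add]
    refine Nat.pow_le_pow_right (by norm_num) ?_
    have := card_filter_add_card_filter_not (s := S) (fun e => b e = true)
    have hb' : #{e ∈ S | b e} < T := (mem_filter.1 hb).2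
    omega
  have hE : #S ≤ Fintype.card E := card_le_univ S
  -- `2 * 3 ^ 3 ≤ 4 ^ 3`, which is where the factor `3` in `h` comes from
  have hnum : 2 ^ (T + a) * 3 ^ #S ≤ 2 ^ #S * 2 ^ #S := by
    obtain ⟨d, hd⟩ := Nat.exists_eq_add_of_le h
    rw [hd, ← mul_pow, pow_add 3, pow_add (2 * 2), pow_mul 3, pow_mul (2 * 2), ← mul_assoc,
      ← mul_pow]
    exact Nat.mul_le_mul (Nat.pow_le_pow_left (by norm_num) _)
      (Nat.pow_le_pow_left (by norm_num) _)
  have hcard : Fintype.card (E → Bool) = 2 ^ (Fintype.card E - #S) * 2 ^ #S := by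
    rw [Fintype.card_fun, Fintype.card_bool, ← pow_add]
    congr 1
    omega
  have hfin : #bad * 2 ^ a * (2 ^ T * 3 ^ #S) ≤ Fintype.card (E → Bool) * (2 ^ T * 3 ^ #S) := by
    rw [hcard]
    calc #bad * 2 ^ a * (2 ^ T * 3 ^ #S) = #bad * (2 ^ (T + a) * 3 ^ #S) := by
          rw [pow_add]; ring
      _ ≤ #bad * (2 ^ #S * 2 ^ #S) := Nat.mul_le_mul_left _ hnum
      _ = (#bad * 2 ^ #S) * 2 ^ #S := by ring
      _ ≤ _ := Nat.mul_le_mul_right _ hmarkov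
      _ = _ := by ring
  exact le_of_mul_le_mul_right hfin (by positivity)

/-- If an event has probability at most `1 / a` whenever all coordinates but the `j`-th are fixed and
the `j`-th one is uniformly random, then its probability is at most `1 / a`. -/
lemma card_filter_mul_le_of_update {ι X : Type} [Fintype ι] [DecidableEq ι] [Fintype X]
    [Nonempty X] (P : (ι → X) → Prop) [DecidablePred P] (j : ι) (a : ℕ)
    (h : ∀ f : ι → X, #{x | P (Function.update f j x)} * a ≤ Fintype.card X) :
    #{f | P f} * a ≤ Fintype.card (ι → X) := by
  classical
  have hbij : #{p : (ι → X) × X | P (Function.update p.1 j p.2)} =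
      #{f | P f} * Fintype.card X := by
    rw [← card_univ, ← card_product]
    -- exchanging `x` with the `j`-th coordinate of `f` is an involution
    refine card_nbij' (fun p => (Function.update p.1 j p.2, p.1 j))
      (fun p => (Function.update p.1 j p.2, p.1 j)) ?_ ?_ ?_ ?_ <;>
    · rintro ⟨f, x⟩ hp
      simp_all
  have hsum : #{p : (ι → X) × X | P (Function.update p.1 j p.2)} =
      ∑ f, #{x | P (Function.update f j x)} := by
    simp_rw [card_filter, Fintype.sum_prod_type]
  have : #{f | P f} * a * Fintype.card X ≤ Fintype.card (ι → X) * Fintype.card X := by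
    calc #{f | P f} * a * Fintype.card X = (#{f | P f} * Fintype.card X) * a := by ring
      _ = ∑ f, #{x | P (Function.update f j x)} * a := by rw [← hbij, hsum, sum_mul]
      _ ≤ ∑ _f : ι → X, Fintype.card X := sum_le_sum fun f _ => h f
      _ = _ := by simp
  exact le_of_mul_le_mul_right this Fintype.card_pos

lemma card_filter_fst_mul_le {X Y : Type} [Fintype X] [Fintype Y] (P : X → Prop)
    [DecidablePred P] (a : ℕ) (h : #{x | P x} * a ≤ Fintype.card X) :
    #{p : X × Y | P p.1} * a ≤ Fintype.card (X × Y) := by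
  have : #{p : X × Y | P p.1} = #{x | P x} * Fintype.card Y := by
    rw [← card_univ, ← card_product]
    congr 1
    ext p
    simp
  rw [this, Fintype.card_prod, mul_right_comm]
  exact Nat.mul_le_mul_right _ h

lemma card_filter_prod_mul_le {X Y : Type} [Fintype X] [Fintype Y] (P : X → Y → Prop)
    [∀ x, DecidablePred (P x)] (a : ℕ) (h : ∀ x, #{y | P x y} * a ≤ Fintype.card Y) :
    #{p : X × Y | P p.1 p.2} * a ≤ Fintype.card (X × Y) := by
  have : #{p : X × Y | P p.1 p.2} = ∑ x, #{y | P x y} := by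
    simp_rw [card_filter, Fintype.sum_prod_type]
  rw [this, sum_mul, Fintype.card_prod, ← card_univ, ← smul_eq_mul (#univ), ← sum_const]
  exact sum_le_sum fun x _ => h x

/-- The union bound, for events of probability at most `1 / b` each. -/
lemma card_filter_exists_mul_le {ι Ω : Type} [Fintype ι] [Fintype Ω] (P : ι → Ω → Prop)
    [∀ i, DecidablePred (P i)] [DecidablePred fun ω => ∃ i, P i ω] (a b : ℕ)
    (h : ∀ i, #{ω | P i ω} * b ≤ Fintype.card Ω) (hab : Fintype.card ι * a ≤ b) :
    #{ω | ∃ i, P i ω} * a ≤ Fintype.card Ω := by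
  classical
  have h1 : #{ω | ∃ i, P i ω} ≤ ∑ i, #{ω | P i ω} := by
    refine (card_le_card ?_).trans card_biUnion_le
    intro ω
    simp
  rcases isEmpty_or_nonempty ι with hι | hι
  · simp
  have h2 : #{ω | ∃ i, P i ω} * a * Fintype.card ι ≤ Fintype.card Ω * Fintype.card ι := by
    calc _ = #{ω | ∃ i, P i ω} * (Fintype.card ι * a) := by ring
      _ ≤ #{ω | ∃ i, P i ω} * b := Nat.mul_le_mul_left _ hab
      _ ≤ (∑ i, #{ω | P i ω}) * b := Nat.mul_le_mul_right _ h1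
      _ = ∑ i, #{ω | P i ω} * b := sum_mul _ _ _
      _ ≤ ∑ _i : ι, Fintype.card Ω := sum_le_sum fun i _ => h i
      _ = _ := by simp [mul_comm]
  exact le_of_mul_le_mul_right h2 Fintype.card_pos

lemma card_filter_mul_le_of_imp_or {Ω : Type} [Fintype Ω] {P P₁ P₂ P₃ : Ω → Prop}
    [DecidablePred P] [DecidablePred P₁] [DecidablePred P₂] [DecidablePred P₃] {a : ℕ}
    (h : ∀ ω, P ω → P₁ ω ∨ P₂ ω ∨ P₃ ω) (h₁ : #{ω | P₁ ω} * (3 * a) ≤ Fintype.card Ω)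
    (h₂ : #{ω | P₂ ω} * (3 * a) ≤ Fintype.card Ω) (h₃ : #{ω | P₃ ω} * (3 * a) ≤ Fintype.card Ω) :
    #{ω | P ω} * a ≤ Fintype.card Ω := by
  classical
  have hsub : ({ω | P ω} : Finset Ω) ⊆
      univ.filter P₁ ∪ (univ.filter P₂ ∪ univ.filter P₃) := by
    intro ω
    simpa using h ω
  have hcard := (card_le_card hsub).trans ((card_union_le _ _).trans
    (Nat.add_le_add_left (card_union_le _ _) _))
  have := Nat.mul_le_mul_right (3 * a) hcard
  linarith

/-- If for every input a uniformly random `ω : Ω` is bad with probability at most `1 / N`, then `N`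
fixed elements of `Ω` can be chosen among which every input has fewer than `t` bad ones, where `2 ^ t`
exceeds three times the number of inputs. A random choice works: for each input the expectation of
`2 ^ (number of bad elements)` is at most `(1 + 1 / N) ^ N ≤ 3`. -/
lemma exists_seed_table {X Ω : Type} [Fintype X] [Fintype Ω] [Nonempty Ω] (bad : X → Ω → Prop)
    [∀ x, DecidablePred (bad x)] (N t : ℕ) (hbad : ∀ x, #{ω | bad x ω} * N ≤ Fintype.card Ω)
    (ht : 3 * Fintype.card X < 2 ^ t) :
    ∃ table : Fin N → Ω, ∀ x, #{i | bad x (table i)} < t := by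
  classical
  by_contra! hcon
  have hmoment (x : X) : ∑ f : Fin N → Ω, 2 ^ #{i | bad x (f i)} =
      (Fintype.card Ω + #{ω | bad x ω}) ^ N := by
    have h1 : ∀ f : Fin N → Ω, 2 ^ #{i | bad x (f i)} =
        ∏ i, (if bad x (f i) then 2 else 1) := by
      intro f
      rw [prod_ite, prod_const, prod_const_one, mul_one]
    simp_rw [h1]
    rw [← Fintype.prod_sum (fun (_ : Fin N) (ω : Ω) => if bad x ω then 2 else 1), prod_const,
      card_univ, Fintype.card_fin]
    congr 1
    have : ∀ ω, (if bad x ω then 2 else 1) = 1 + if bad x ω then 1 else 0 := by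
      intro ω; split_ifs <;> rfl
    simp_rw [this, sum_add_distrib, ← card_filter]
    simp
  have hpow (x : X) : (Fintype.card Ω + #{ω | bad x ω}) ^ N ≤ 3 * Fintype.card Ω ^ N := by
    rcases Nat.eq_zero_or_pos N with rfl | hN
    · simp
    have hΩ : (0 : ℝ) < Fintype.card Ω := by exact_mod_cast Fintype.card_pos
    have hN' : (0 : ℝ) < N := by exact_mod_cast hN
    have h1 : (#{ω | bad x ω} : ℝ) ≤ Fintype.card Ω * (N : ℝ)⁻¹ := by
      rw [le_mul_inv_iff₀ hN']
      exact_mod_cast hbad x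
    have h2 : ((Fintype.card Ω : ℝ) + #{ω | bad x ω}) ^ N ≤ 3 * (Fintype.card Ω : ℝ) ^ N := by
      calc ((Fintype.card Ω : ℝ) + #{ω | bad x ω}) ^ N
          ≤ (Fintype.card Ω * (1 + (N : ℝ)⁻¹)) ^ N := by
            refine pow_le_pow_left₀ (by positivity) ?_ _
            linarith
        _ = (1 + (N : ℝ)⁻¹) ^ N * (Fintype.card Ω : ℝ) ^ N := by rw [mul_pow, mul_comm]
        _ ≤ 3 * (Fintype.card Ω : ℝ) ^ N := by
            refine mul_le_mul_of_nonneg_right ?_ (by positivity)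
            calc (1 + (N : ℝ)⁻¹) ^ N ≤ Real.exp ((N : ℝ)⁻¹) ^ N := by
                  refine pow_le_pow_left₀ (by positivity) ?_ _
                  rw [add_comm]
                  exact Real.add_one_le_exp _
              _ = Real.exp 1 := by
                  rw [← Real.exp_nat_mul, mul_inv_cancel₀ hN'.ne']
              _ ≤ 3 := Real.exp_one_lt_three.le
    exact_mod_cast h2
  have hlow : Fintype.card (Fin N → Ω) * 2 ^ t ≤
      ∑ f : Fin N → Ω, ∑ x, 2 ^ #{i | bad x (f i)} := by
    rw [← card_univ, ← smul_eq_mul, ← sum_const]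
    refine sum_le_sum fun f _ => ?_
    obtain ⟨x, hx⟩ := hcon f
    exact (Nat.pow_le_pow_right (by norm_num) hx).trans
      (single_le_sum (f := fun x => 2 ^ #{i | bad x (f i)}) (fun _ _ => Nat.zero_le _)
        (mem_univ x))
  rw [sum_comm, Fintype.card_fun, Fintype.card_fin] at hlow
  have hup : ∑ x, ∑ f : Fin N → Ω, 2 ^ #{i | bad x (f i)} ≤
      Fintype.card X * (3 * Fintype.card Ω ^ N) := by
    rw [← card_univ, ← smul_eq_mul (#univ), ← sum_const]
    exact sum_le_sum fun x _ => (hmoment x).trans_le (hpow x)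
  have hpos : 0 < Fintype.card Ω ^ N := pow_pos Fintype.card_pos _
  have : Fintype.card Ω ^ N * 2 ^ t ≤ Fintype.card Ω ^ N * (3 * Fintype.card X) :=
    (hlow.trans hup).trans_eq (by ring)
  exact absurd (le_of_mul_le_mul_left this hpos) (not_le.2 ht)

end Counting

/-! ### Recovering many elements of the support from a linear sketch -/

section Sampler

open Finset

variable {E A : Type}

section Levels

variable [AddCommGroup A]

/-- The restriction of a vector to the `j`-th level of the subsampling given by `R`: the
coordinates that are selected by all of `R 0, …, R (j - 1)`. -/
def levelRestrict {J : ℕ} (R : Fin J → E → Bool) (j : ℕ) : (E → A) →+ (E → A) where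
  toFun x e := if ∀ i : Fin J, i.val < j → R i e = true then x e else 0
  map_zero' := by ext; simp
  map_add' x y := by ext e; simp only [Pi.add_apply]; split_ifs <;> simp

lemma levelRestrict_apply {J : ℕ} (R : Fin J → E → Bool) (j : ℕ) (x : E → A) (e : E) :
    levelRestrict R j x e = if ∀ i : Fin J, i.val < j → R i e = true then x e else 0 := rfl

lemma levelRestrict_zero_level {J : ℕ} (R : Fin J → E → Bool) (x : E → A) :
    levelRestrict R 0 x = x := by
  ext e; simp [levelRestrict_apply]

lemma levelRestrict_update {J : ℕ} (R : Fin J → E → Bool) (j : Fin J)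
    (b : E → Bool) (x : E → A) :
    levelRestrict (Function.update R j b) j x = levelRestrict R j x := by
  ext e
  simp only [levelRestrict_apply]
  congr 1
  refine propext (forall_congr' fun i => forall_congr' fun hi => ?_)
  have hne : i ≠ j := fun h => by simp [h] at hi
  rw [Function.update_of_ne hne]

end Levels

variable [Fintype E] [AddCommGroup A]

/-- The support of a vector, as a finite set. -/
noncomputable def supp (x : E → A) : Finset E := by
  classical exact {e | x e ≠ 0}

@[simp] lemma mem_supp {x : E → A} {e : E} : e ∈ supp x ↔ x e ≠ 0 := by
  simp [supp]

/-- The linear sketch that stores the sum of the coordinates over each of the sets `B i`. -/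
def sketch {r : ℕ} (B : Fin r → E → Bool) : (E → A) →+ (Fin r → A) where
  toFun x i := ∑ e, if B i e then x e else 0
  map_zero' := by ext; simp
  map_add' x y := by
    ext i
    simp only [Pi.add_apply, ← sum_add_distrib]
    exact sum_congr rfl fun e _ => by split_ifs <;> simp

lemma sketch_apply {r : ℕ} (B : Fin r → E → Bool) (x : E → A) (i : Fin r) :
    sketch B x i = ∑ e, if B i e then x e else 0 := rfl

lemma supp_levelRestrict_subset {J : ℕ} (R : Fin J → E → Bool) (j : ℕ) (x : E → A) :
    supp (levelRestrict R j x) ⊆ supp x := by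
  intro e
  simp only [mem_supp, levelRestrict_apply]
  split_ifs <;> simp

/-- The seed `(R, B)` is good for `x` if subsampling never drops the support from more than `K`
to fewer than `T` elements in one step, if it ends with nothing, and if at every level the
sketch differs from that of every other `K`-sparse vector. -/
structure IsGoodSeed {J r : ℕ} (T K : ℕ) (x : E → A) (R : Fin J → E → Bool)
    (B : Fin r → E → Bool) : Prop where
  le_card_succ : ∀ j : Fin J, K < #(supp (levelRestrict R j x)) →
    T ≤ #(supp (levelRestrict R (j + 1) x))
  last : levelRestrict R J x = 0
  unique : ∀ j : Fin (J + 1), ∀ y : E → A, #(supp y) ≤ K →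
    sketch B y = sketch B (levelRestrict R j x) → y = levelRestrict R j x

/-- `y` is a `K`-sparse vector that explains the sketch `σ j` of the first level `j` whose sketch
can be explained by a `K`-sparse vector. -/
def IsDecoding {J r : ℕ} (K : ℕ) (B : Fin r → E → Bool) (σ : Fin (J + 1) → Fin r → A)
    (y : E → A) : Prop :=
  #(supp y) ≤ K ∧ ∃ j, sketch B y = σ j ∧
    ∀ i < j, ∀ y' : E → A, #(supp y') ≤ K → sketch B y' ≠ σ i

lemma IsGoodSeed.exists_isDecoding {J r T K : ℕ} {x : E → A} {R : Fin J → E → Bool}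
    {B : Fin r → E → Bool} (h : IsGoodSeed T K x R B) :
    ∃ y, IsDecoding K B (fun j : Fin (J + 1) => sketch B (levelRestrict R j x)) y := by
  classical
  have hlast : ∃ j : Fin (J + 1), ∃ y : E → A, #(supp y) ≤ K ∧
      sketch B y = sketch B (levelRestrict R j x) :=
    ⟨Fin.last J, 0, by simp [supp], by simp [h.last]⟩
  obtain ⟨j, ⟨y, hy, hyj⟩, hmin⟩ := WellFounded.has_min wellFounded_lt
    {j : Fin (J + 1) | ∃ y : E → A, #(supp y) ≤ K ∧ sketch B y = sketch B (levelRestrict R j x)}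
    hlast
  exact ⟨y, hy, j, hyj, fun i hi y' hy' heq => hmin i ⟨y', hy', heq⟩ hi⟩

/-- For a good seed a decoding is the restriction of `x` to the first level on which it is
`K`-sparse. If that is not level `0`, then the level before has a support of more than `K` elements,
so at least `T` of them are left. -/
lemma IsGoodSeed.supp_of_isDecoding {J r T K : ℕ} {x : E → A} {R : Fin J → E → Bool}
    {B : Fin r → E → Bool} (h : IsGoodSeed T K x R B) {y : E → A}
    (hy : IsDecoding K B (fun j : Fin (J + 1) => sketch B (levelRestrict R j x)) y) :
    supp y ⊆ supp x ∧ (supp y = supp x ∨ T ≤ #(supp y)) := by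
  obtain ⟨hyK, j, hj, hfirst⟩ := hy
  obtain rfl := h.unique j y hyK hj
  refine ⟨supp_levelRestrict_subset R j x, ?_⟩
  induction j using Fin.cases with
  | zero => left; simp [levelRestrict_zero_level]
  | succ i =>
    right
    refine h.le_card_succ i ?_
    by_contra! hle
    exact hfirst i.castSucc (Fin.castSucc_lt_succ) _ hle rfl

/-- A `K`-sparse vector is described by `K` pairs of a coordinate and a value; the number of such
descriptions is what enters the union bound over all sparse vectors. -/
lemma exists_sum_single_of_card_supp_le [DecidableEq E] [Nonempty E] {K : ℕ} (y : E → A)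
    (hy : #(supp y) ≤ K) :
    ∃ c : Fin K → E × A, y = ∑ k, Pi.single (c k).1 (c k).2 := by
  classical
  induction K generalizing y with
  | zero =>
    refine ⟨Fin.elim0, ?_⟩
    have : supp y = ∅ := by simpa using hy
    ext e
    have := mt (mem_supp (x := y) (e := e)).2 (by simp [this])
    simpa using this
  | succ K ih =>
    by_cases h : ∃ e, y e ≠ 0
    · obtain ⟨e, he⟩ := h
      obtain ⟨c, hc⟩ := ih (y - Pi.single e (y e)) (by
        have hsub : supp (y - Pi.single e (y e)) ⊆ (supp y).erase e := by
          intro e' he'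
          rw [mem_supp] at he'
          rw [mem_erase, mem_supp]
          rcases eq_or_ne e' e with rfl | hne
          · simp at he'
          · exact ⟨hne, by simpa [hne] using he'⟩
        have := card_le_card hsub
        rw [card_erase_of_mem (by simpa using he)] at this
        omega)
      refine ⟨Fin.cons (e, y e) c, ?_⟩
      rw [Fin.sum_univ_succ]
      simp only [Fin.cons_zero, Fin.cons_succ, ← hc]
      abel
    · push Not at h
      obtain ⟨e₀⟩ := ‹Nonempty E›
      refine ⟨fun _ => (e₀, 0), ?_⟩
      ext e
      simp [h]

lemma supp_levelRestrict_succ_update [DecidableEq E] {J : ℕ} (R : Fin J → E → Bool) (j : Fin J)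
    (b : E → Bool) (x : E → A) :
    supp (levelRestrict (Function.update R j b) (j + 1) x) =
      {e ∈ supp (levelRestrict R j x) | b e} := by
  classical
  ext e
  simp only [mem_supp, mem_filter, levelRestrict_apply, ne_eq, ite_eq_right_iff, not_forall]
  constructor
  · rintro ⟨hR, hx⟩
    refine ⟨⟨fun i hi => ?_, hx⟩, by simpa using hR j (by simp)⟩
    have hne : i ≠ j := fun h => by simp [h] at hi
    simpa [hne] using hR i (by omega)
  · rintro ⟨⟨hR, hx⟩, hb⟩
    refine ⟨fun i hi => ?_, hx⟩
    rcases eq_or_ne i j with rfl | hne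
    · simpa using hb
    · rw [Function.update_of_ne hne]
      exact hR i (by have := Fin.val_ne_of_ne hne; omega)

lemma card_sketch_eq_mul_le [DecidableEq E] [DecidableEq A] {y z : E → A} (h : y ≠ z) (r : ℕ) :
    #{B : Fin r → E → Bool | sketch B y = sketch B z} * 2 ^ r ≤
      Fintype.card (Fin r → E → Bool) := by
  refine le_trans (Nat.mul_le_mul_right _ (card_le_card ?_)) (card_filter_forall_mul_le
    (fun b : E → Bool => ∑ e, (if b e then (y - z) e else 0) = 0) r
    (two_mul_card_filter_sum_eq_zero_le (sub_ne_zero.2 h)))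
  intro B hB
  rw [mem_filter] at hB ⊢
  refine ⟨mem_univ _, fun i => ?_⟩
  rw [← sketch_apply, map_sub, hB.2, sub_self, Pi.zero_apply]

lemma card_apply_eq_true_mul_le [DecidableEq E] (e : E) :
    #{b : E → Bool | b e = true} * 2 ≤ Fintype.card (E → Bool) := by
  -- complementing a subset of `E` toggles the membership of `e`
  have h1 : #{b : E → Bool | b e = true} ≤ #{b : E → Bool | ¬ b e = true} :=
    card_le_card_of_injOn (fun b e => !b e) (by intro b; simp)
      (by
        intro b _ b' _ h
        ext e
        simpa using congrFun h e)
  have h2 := card_filter_add_card_filter_not (s := (univ : Finset (E → Bool)))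
    (fun b => b e = true)
  rw [card_univ] at h2
  omega

open Classical in
/-- The `j`-th step keeps a random subset of the support at level `j`, which does not depend on
`R j`. So with high probability no step reduces more than `K` elements to fewer than `T`. -/
lemma card_exists_drop_mul_le (x : E → A) {J T K : ℕ} (a b : ℕ)
    (hK : 3 * (T + b) ≤ K) (hb : J * a ≤ 2 ^ b) :
    #{R : Fin J → E → Bool | ∃ j : Fin J, K < #(supp (levelRestrict R j x)) ∧
      #(supp (levelRestrict R (j + 1) x)) < T} * a ≤ Fintype.card (Fin J → E → Bool) := by
  refine card_filter_exists_mul_le (fun (j : Fin J) (R : Fin J → E → Bool) =>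
    K < #(supp (levelRestrict R j x)) ∧ #(supp (levelRestrict R (j + 1) x)) < T) _ (2 ^ b)
    (fun j => card_filter_mul_le_of_update _ j _ fun R => ?_) (by simpa using hb)
  simp only [supp_levelRestrict_succ_update, levelRestrict_update]
  by_cases hlarge : K < #(supp (levelRestrict R j x))
  · simp only [hlarge, true_and]
    exact card_filter_card_lt_mul_le _ T b (hK.trans hlarge.le)
  · simp [hlarge]

open Classical in
lemma card_exists_forall_mul_le {J : ℕ} (a : ℕ) (hJ : Fintype.card E * a ≤ 2 ^ J) :
    #{R : Fin J → E → Bool | ∃ e : E, ∀ i, R i e = true} * a ≤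
      Fintype.card (Fin J → E → Bool) :=
  card_filter_exists_mul_le (fun (e : E) (R : Fin J → E → Bool) => ∀ i, R i e = true) _ (2 ^ J)
    (fun e => card_filter_forall_mul_le (fun b : E → Bool => b e = true) J
      (card_apply_eq_true_mul_le e)) hJ

open Classical in
lemma card_exists_collision_mul_le [Nonempty E] [Fintype A] {m r K : ℕ} (z : Fin m → E → A)
    (a : ℕ) (hr : m * (Fintype.card E * Fintype.card A) ^ K * a ≤ 2 ^ r) :
    #{B : Fin r → E → Bool | ∃ (j : Fin m) (y : E → A),
      #(supp y) ≤ K ∧ y ≠ z j ∧ sketch B y = sketch B (z j)} * a ≤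
      Fintype.card (Fin r → E → Bool) := by
  have hcard : Fintype.card (Fin m × (Fin K → E × A)) * a ≤ 2 ^ r := by simpa using hr
  refine le_trans (Nat.mul_le_mul_right _ (card_le_card ?_)) (card_filter_exists_mul_le
    (fun (p : Fin m × (Fin K → E × A)) (B : Fin r → E → Bool) =>
      (∑ k, Pi.single (p.2 k).1 (p.2 k).2 : E → A) ≠ z p.1 ∧
        sketch B (∑ k, Pi.single (p.2 k).1 (p.2 k).2 : E → A) = sketch B (z p.1))
    a (2 ^ r) (fun p => ?_) hcard)
  · intro B hB
    obtain ⟨j, y, hy, hne, heq⟩ := (mem_filter.1 hB).2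
    obtain ⟨c, rfl⟩ := exists_sum_single_of_card_supp_le y hy
    exact mem_filter.2 ⟨mem_univ _, (j, c), hne, heq⟩
  · by_cases h : (∑ k, Pi.single (p.2 k).1 (p.2 k).2 : E → A) = z p.1
    · simp [h]
    · simp only [ne_eq, h, not_false_eq_true, true_and]
      exact card_sketch_eq_mul_le h r

open Classical in
lemma card_not_isGoodSeed_mul_le [Nonempty E] [Fintype A] (x : E → A) {J r T K : ℕ} (a b : ℕ)
    (hK : 3 * (T + b) ≤ K) (hb : J * (3 * a) ≤ 2 ^ b)
    (hJ : Fintype.card E * (3 * a) ≤ 2 ^ J)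
    (hr : (J + 1) * (Fintype.card E * Fintype.card A) ^ K * (3 * a) ≤ 2 ^ r) :
    #{ω : (Fin J → E → Bool) × (Fin r → E → Bool) | ¬ IsGoodSeed T K x ω.1 ω.2} * a ≤
      Fintype.card ((Fin J → E → Bool) × (Fin r → E → Bool)) := by
  have hdrop := card_filter_fst_mul_le (Y := Fin r → E → Bool) _ _
    (card_exists_drop_mul_le x (3 * a) b hK hb)
  have hlast := card_filter_fst_mul_le (Y := Fin r → E → Bool) _ _
    (card_exists_forall_mul_le (E := E) (3 * a) hJ)
  have hcoll := card_filter_prod_mul_le (X := Fin J → E → Bool) _ (3 * a)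
    (fun R => card_exists_collision_mul_le (fun j : Fin (J + 1) => levelRestrict R j x)
      (3 * a) hr)
  refine card_filter_mul_le_of_imp_or (fun ω hω => ?_) hdrop hlast hcoll
  contrapose! hω
  obtain ⟨h1, h2, h3⟩ := hω
  refine ⟨h1, ?_, ?_⟩
  · ext e
    rw [levelRestrict_apply, if_neg, Pi.zero_apply]
    intro h
    obtain ⟨i, hi⟩ := h2 e
    exact hi (h i i.2)
  · intro j y hy heq
    by_contra hne
    exact h3 j y hy hne heq

open Classical in
/-- There are `N` linear sketches with decoders such that, for every vector `x`, all but fewer than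
`t` of them recover the whole support of `x` or at least `T` of its elements. -/
lemma exists_support_sampler [Nonempty E] [Fintype A] {T K J r b N t : ℕ}
    (hK : 3 * (T + b) ≤ K) (hb : J * (3 * N) ≤ 2 ^ b) (hJ : Fintype.card E * (3 * N) ≤ 2 ^ J)
    (hr : (J + 1) * (Fintype.card E * Fintype.card A) ^ K * (3 * N) ≤ 2 ^ r)
    (ht : 3 * Fintype.card A ^ Fintype.card E < 2 ^ t) :
    ∃ (φ : Fin N → (E → A) →+ (Fin (J + 1) → Fin r → A))
      (dec : Fin N → (Fin (J + 1) → Fin r → A) → Finset E),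
      ∀ x, ∃ bad : Finset (Fin N), #bad < t ∧ ∀ i ∉ bad,
        dec i (φ i x) ⊆ supp x ∧ (dec i (φ i x) = supp x ∨ T ≤ #(dec i (φ i x))) := by
  obtain ⟨table, htable⟩ := exists_seed_table
    (fun (x : E → A) (ω : (Fin J → E → Bool) × (Fin r → E → Bool)) =>
      ¬ IsGoodSeed T K x ω.1 ω.2) N t
    (fun x => card_not_isGoodSeed_mul_le x N b hK hb hJ hr) (by simpa using ht)
  refine ⟨fun i => AddMonoidHom.pi fun j : Fin (J + 1) =>
      (sketch (table i).2).comp (levelRestrict (table i).1 j),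
    fun i σ => if h : ∃ y, IsDecoding K (table i).2 σ y then supp h.choose else ∅,
    fun x => ⟨_, htable x, fun i hi => ?_⟩⟩
  have hgood : IsGoodSeed T K x (table i).1 (table i).2 := by simpa using hi
  have hdec := hgood.exists_isDecoding
  have heq : (if h : ∃ y, IsDecoding K (table i).2
      (fun j : Fin (J + 1) => sketch (table i).2 (levelRestrict (table i).1 j x)) y
      then supp h.choose else ∅) = supp hdec.choose := dif_pos hdec
  have hspec := hgood.supp_of_isDecoding hdec.choose_spec
  rw [← heq] at hspec
  exact hspec

end Sampler

/-! ### From linear sketches to streaming algorithms -/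

section Streaming

open Finset

/-- An automaton whose states fit into `s` bits, and whose only randomness is the choice of its
initial state by a uniformly random `i : Fin N`, is a streaming algorithm. -/
lemma StreamAlg.exists_of_card_le {U O Q : Type} [Fintype Q] {s N : ℕ} [NeZero N]
    (hQ : Fintype.card Q ≤ 2 ^ s) (init : Fin N → Q) (step : Q → U → Q) (out : Q → O) :
    ∃ A : StreamAlg U O s, ∀ (l : List U) (S : Set O),
      A.prob l S = (PMF.uniformOfFintype (Fin N)).toOuterMeasure
        {i | out (l.foldl step (init i)) ∈ S} := by
  obtain ⟨enc⟩ : Nonempty (Q ↪ (Fin s → Bool)) :=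
    Function.Embedding.nonempty_of_card_le (by simpa using hQ)
  have : Nonempty Q := ⟨init 0⟩
  have hdec : ∀ q, Function.invFun enc (enc q) = q := Function.leftInverse_invFun enc.injective
  refine ⟨⟨(PMF.uniformOfFintype (Fin N)).map (fun i => enc (init i)),
    fun m u => PMF.pure (enc (step (Function.invFun enc m) u)),
    fun m => PMF.pure (out (Function.invFun enc m))⟩, fun l S => ?_⟩
  have hmem : ∀ (l : List U) (f : Fin N → Q),
      l.foldl (fun μ u => PMF.bind μ fun m => PMF.pure (enc (step (Function.invFun enc m) u)))
        ((PMF.uniformOfFintype (Fin N)).map (fun i => enc (f i))) =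
      (PMF.uniformOfFintype (Fin N)).map (fun i => enc (l.foldl step (f i))) := by
    intro l
    induction l with
    | nil => intro f; rfl
    | cons u l ih =>
      intro f
      rw [List.foldl_cons, PMF.bind_map]
      simp only [Function.comp_def, hdec]
      exact ih (fun i => step (f i) u)
  rw [StreamAlg.prob, StreamAlg.run, StreamAlg.memory, hmem, PMF.bind_map]
  simp only [Function.comp_def, hdec]
  have h := PMF.toOuterMeasure_map_apply (fun i => out (l.foldl step (init i)))
    (PMF.uniformOfFintype (Fin N)) S
  exact h

lemma le_toOuterMeasure_uniformOfFintype {N b t : ℕ} [NeZero N] {S : Set (Fin N)}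
    {bad : Finset (Fin N)} (h : ∀ i ∉ bad, i ∈ S) (hbad : #bad ≤ t)
    (hb : 0 < b) (ht : t * b ≤ N) :
    1 - (b : ℝ≥0∞)⁻¹ ≤ (PMF.uniformOfFintype (Fin N)).toOuterMeasure S := by
  classical
  rw [PMF.toOuterMeasure_uniformOfFintype_apply]
  have hN : (N : ℝ≥0∞) ≠ 0 := by exact_mod_cast NeZero.ne N
  have hb' : (b : ℝ≥0∞) ≠ 0 := by exact_mod_cast hb.ne'
  have hcard : N ≤ Fintype.card S + t := by
    have h1 := card_compl_add_card bad
    have h2 : #badᶜ ≤ Fintype.card S := by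
      rw [← Set.toFinset_card]
      refine card_le_card fun i hi => ?_
      simpa using h i (by simpa using hi)
    rw [Fintype.card_fin] at h1
    omega
  rw [Fintype.card_fin, ENNReal.le_div_iff_mul_le (Or.inl hN) (Or.inl (ENNReal.natCast_ne_top N)),
    ENNReal.sub_mul (fun _ _ => ENNReal.natCast_ne_top N), one_mul, tsub_le_iff_right]
  calc (N : ℝ≥0∞) ≤ Fintype.card S + t := by exact_mod_cast hcard
    _ ≤ Fintype.card S + (b : ℝ≥0∞)⁻¹ * N := by
      gcongr
      rw [← ENNReal.div_eq_inv_mul, ENNReal.le_div_iff_mul_le (Or.inl hb')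
        (Or.inl (ENNReal.natCast_ne_top b))]
      exact_mod_cast ht

/-- The vector of multiplicities after the updates `l`, reduced to an additive group `A`
with a distinguished element `1`. -/
def multiplicityVector {n : ℕ} (A : Type) [AddCommGroupWithOne A]
    (l : List (Bool × Sym2 (Fin n))) (e : Sym2 (Fin n)) : A :=
  (multiplicityAfter l e : A)

/-- The change of the multiplicity vector that an update causes. -/
def updateVector {n : ℕ} (A : Type) [AddCommGroupWithOne A] (u : Bool × Sym2 (Fin n)) :
    Sym2 (Fin n) → A :=
  Pi.single u.2 (if u.1 then 1 else -1)

lemma multiplicityVector_cons {n : ℕ} (A : Type) [AddCommGroupWithOne A]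
    (u : Bool × Sym2 (Fin n)) (l : List (Bool × Sym2 (Fin n))) :
    multiplicityVector A (u :: l) = updateVector A u + multiplicityVector A l := by
  ext e
  obtain ⟨b, f⟩ := u
  simp only [multiplicityVector, updateVector, multiplicityAfter, List.count_cons, Pi.add_apply,
    Pi.single_apply, beq_iff_eq, Prod.mk.injEq, eq_comm (a := f)]
  by_cases h : e = f <;> cases b <;> simp [h] <;> abel

lemma foldl_add_updateVector {n : ℕ} {A W : Type} [AddCommGroupWithOne A] [AddCommGroup W]
    (φ : (Sym2 (Fin n) → A) →+ W) (l : List (Bool × Sym2 (Fin n))) (w : W) :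
    l.foldl (fun w u => w + φ (updateVector A u)) w = w + φ (multiplicityVector A l) := by
  induction l generalizing w with
  | nil =>
    have : multiplicityVector A ([] : List (Bool × Sym2 (Fin n))) = 0 := by
      ext e; simp [multiplicityVector, multiplicityAfter]
    simp [this]
  | cons u l ih => rw [List.foldl_cons, ih, multiplicityVector_cons, map_add, add_assoc]

lemma coe_supp_multiplicityVector {n M : ℕ} {G : SimpleGraph (Fin n)}
    {l : List (Bool × Sym2 (Fin n))} (h : IsInsertionDeletionStream M G l) :
    (supp (multiplicityVector (ZMod (M + 1)) l) : Set (Sym2 (Fin n))) = G.edgeSet := by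
  ext e
  obtain ⟨h0, hM⟩ := h.2.1 l (List.prefix_refl l) e
  rw [Finset.mem_coe, mem_supp, h.2.2 e, multiplicityVector, Ne, ZMod.intCast_zmod_eq_zero_iff_dvd]
  constructor
  · intro hd
    rcases h0.lt_or_eq with h' | h'
    · exact h'
    · exact absurd (h' ▸ dvd_zero _) hd
  · -- multiplicities are at most `M`, so a positive one is nonzero modulo `M + 1`
    intro hpos hd
    have := Int.le_of_dvd hpos hd
    push_cast at this
    omega

/-- An insertion-only stream is an insertion-deletion stream of multiplicities at most `1`, so the
algorithm for the latter model serves both. -/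
lemma IsInsertionOnlyStream.isInsertionDeletionStream {n : ℕ} {G : SimpleGraph (Fin n)}
    {l : List (Sym2 (Fin n))} (h : IsInsertionOnlyStream G l) :
    IsInsertionDeletionStream 1 G (l.map (Prod.mk true)) := by
  have hmult : ∀ (l' : List (Sym2 (Fin n))) (e : Sym2 (Fin n)),
      multiplicityAfter (l'.map (Prod.mk true)) e = l'.count e := by
    intro l' e
    have h1 : (l'.map (Prod.mk true)).count (true, e) = l'.count e :=
      List.count_map_of_injective l' _ (Prod.mk_right_injective true) e
    have h2 : (l'.map (Prod.mk true)).count (false, e) = 0 := by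
      rw [List.count_eq_zero]; simp
    simp [multiplicityAfter, h1, h2]
  refine ⟨?_, ?_, ?_⟩
  · intro x hx
    obtain ⟨e, he, rfl⟩ := List.mem_map.1 hx
    exact G.not_isDiag_of_mem_edgeSet ((h.2 e).1 he)
  · intro l' hl' e
    obtain ⟨l'', hl'', rfl⟩ : ∃ l'', l'' <+: l ∧ l' = l''.map (Prod.mk true) := by
      rw [List.prefix_map_iff] at hl'
      exact hl'
    rw [hmult]
    have := List.nodup_iff_count_le_one.1 (h.1.sublist hl''.sublist) e
    constructor <;> exact_mod_cast (by omega)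
  · intro e
    rw [hmult, ← h.2 e]
    simp

lemma StreamAlg.exists_prob_eq_map {U U' O : Type} {s : ℕ} (A : StreamAlg U O s) (f : U' → U) :
    ∃ A' : StreamAlg U' O s, ∀ l S, A'.prob l S = A.prob (l.map f) S := by
  refine ⟨⟨A.init, fun m u => A.step m (f u), A.out⟩, fun l S => ?_⟩
  simp [StreamAlg.prob, StreamAlg.run, StreamAlg.memory, List.foldl_map]

/-- The streaming algorithm for given parameters: it draws one of `N` sketches at random, maintains the
sketch of the multiplicities modulo `M + 1`, and at the end outputs a longest path among the edges that
the decoder recovers. -/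
lemma exists_insertionDeletion_streamAlg {n : ℕ} [Nonempty (Fin n)] (M : ℕ) {α : ℝ} (hα : 1 ≤ α)
    {T K J r b N t p s : ℕ} [NeZero N]
    (hT : (n : ℝ) ^ 2 / α ≤ T) (hK : 3 * (T + b) ≤ K) (hb : J * (3 * N) ≤ 2 ^ b)
    (hJ : Fintype.card (Sym2 (Fin n)) * (3 * N) ≤ 2 ^ J)
    (hr : (J + 1) * (Fintype.card (Sym2 (Fin n)) * (M + 1)) ^ K * (3 * N) ≤ 2 ^ r)
    (ht : 3 * (M + 1) ^ Fintype.card (Sym2 (Fin n)) < 2 ^ t) (hp : 0 < p) (htp : t * p ≤ N)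
    (hs : N * (M + 1) ^ ((J + 1) * r) ≤ 2 ^ s) :
    ∃ A : StreamAlg (Bool × Sym2 (Fin n)) (List (Fin n)) s,
      ∀ (G : SimpleGraph (Fin n)) (l : List (Bool × Sym2 (Fin n))),
        IsInsertionDeletionStream M G l →
          1 - (p : ℝ≥0∞)⁻¹ ≤ A.prob l {o | IsApproxLongestPath G α o} := by
  have : Nonempty (Sym2 (Fin n)) := Nonempty.map (fun v => s(v, v)) ‹_›
  obtain ⟨φ, dec, hdec⟩ := exists_support_sampler (E := Sym2 (Fin n)) (A := ZMod (M + 1)) hK hb hJ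
    (by simpa [ZMod.card] using hr) (by simpa [ZMod.card] using ht)
  -- the state is the number of the seed together with the sketch
  obtain ⟨A, hA⟩ := StreamAlg.exists_of_card_le (s := s)
    (Q := Fin N × (Fin (J + 1) → Fin r → ZMod (M + 1)))
    (by
      refine le_trans (le_of_eq ?_) hs
      simp [ZMod.card, pow_mul, pow_right_comm])
    (fun i => (i, 0)) (fun q (u : Bool × Sym2 (Fin n)) => (q.1, q.2 + φ q.1 (updateVector _ u)))
    (fun q => longestPathSupport (dec q.1 q.2 : Set (Sym2 (Fin n))))
  refine ⟨A, fun G l hl => ?_⟩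
  obtain ⟨bad, hbad, hgood⟩ := hdec (multiplicityVector _ l)
  rw [hA]
  refine le_toOuterMeasure_uniformOfFintype (fun i hi => ?_) hbad.le hp htp
  obtain ⟨hsub, hlarge⟩ := hgood i hi
  have hfold : ∀ (l : List (Bool × Sym2 (Fin n))) (w : Fin (J + 1) → Fin r → ZMod (M + 1)),
      l.foldl (fun q u => (q.1, q.2 + φ q.1 (updateVector _ u))) (i, w) =
        (i, l.foldl (fun w u => w + φ i (updateVector _ u)) w) := by
    intro l
    induction l with
    | nil => intro w; rfl
    | cons u l ih => intro w; exact ih _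
  have hG := coe_supp_multiplicityVector hl
  rw [Set.mem_ofPred_eq, hfold, foldl_add_updateVector, zero_add]
  refine isApproxLongestPath_longestPathSupport G hα (hG ▸ Finset.coe_subset.2 hsub) ?_
  rcases hlarge with h | h
  · left
    rw [h]
    exact hG
  · right
    rw [Set.ncard_coe_finset, Fintype.card_fin]
    exact hT.trans (by exact_mod_cast h)

end Streaming

/-! ### The choice of the parameters -/

section Parameters

lemma natCast_clog_two_le {n : ℕ} (hn : 2 ≤ n) : (Nat.clog 2 n : ℝ) ≤ 3 * Real.log n := by
  have h1 : 2 ^ (Nat.clog 2 n - 1) < n := Nat.pow_pred_clog_lt_self (by norm_num) (by omega)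
  have hL : 1 ≤ Nat.clog 2 n := Nat.clog_pos (by norm_num) hn
  have h2 : ((Nat.clog 2 n - 1 : ℕ) : ℝ) * Real.log 2 ≤ Real.log n := by
    rw [← Real.log_pow]
    exact Real.log_le_log (by positivity) (by exact_mod_cast h1.le)
  have h3 : Real.log 2 ≤ Real.log n := Real.log_le_log (by norm_num) (by exact_mod_cast hn)
  have h4 := Real.log_two_gt_d9
  rw [Nat.cast_sub hL, Nat.cast_one] at h2
  nlinarith

lemma card_sym2_fin_le (n : ℕ) : Fintype.card (Sym2 (Fin n)) ≤ n ^ 2 := by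
  rw [Sym2.card, Fintype.card_fin, Nat.choose_two_right, Nat.add_sub_cancel]
  refine Nat.div_le_of_le_mul ?_
  nlinarith [Nat.le_self_pow two_ne_zero n]

/-- With `m` possible multiplicities and `e` possible edges there are few enough multiplicity vectors
for a table of seeds with at most `2 ^ ((c + 4) * L)` bad ones. -/
lemma three_mul_pow_lt_two_pow {c L m e : ℕ} (hL : 1 ≤ L) (hm : m ≤ 2 ^ ((c + 1) * L))
    (he : e ≤ 2 ^ (2 * L)) : 3 * m ^ e < 2 ^ 2 ^ ((c + 4) * L) := by
  rcases Nat.eq_zero_or_pos m with rfl | hm0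
  · rcases Nat.eq_zero_or_pos e with rfl | he0
    · have : 2 ^ 2 ≤ 2 ^ 2 ^ ((c + 4) * L) := by
        refine Nat.pow_le_pow_right (by norm_num) ?_
        exact Nat.le_self_pow (by positivity) 2
      omega
    · simp [he0.ne']
  have h1 : m ^ e ≤ 2 ^ ((c + 1) * L * 2 ^ (2 * L)) := by
    rw [pow_mul 2 ((c + 1) * L)]
    exact (Nat.pow_le_pow_right hm0 he).trans (Nat.pow_le_pow_left hm _)
  have h2 : (c + 1) * L * 2 ^ (2 * L) ≤ 2 ^ ((c + 3) * L) := by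
    have hc : c + 1 ≤ 2 ^ (c * L) :=
      (Nat.lt_two_pow_self (n := c)).trans_le
        (Nat.pow_le_pow_right (by norm_num) (Nat.le_mul_of_pos_right c hL))
    calc (c + 1) * L * 2 ^ (2 * L) ≤ 2 ^ (c * L) * 2 ^ L * 2 ^ (2 * L) := by
          gcongr
          exact Nat.lt_two_pow_self.le
      _ = 2 ^ ((c + 3) * L) := by rw [← pow_add, ← pow_add]; congr 1; ring
  have h3 : 8 ≤ 2 ^ ((c + 3) * L) :=
    (Nat.pow_le_pow_right (n := 2) (by norm_num) (by nlinarith : 3 ≤ (c + 3) * L))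
  have h4 : 2 ^ ((c + 3) * L) * 2 ≤ 2 ^ ((c + 4) * L) := by
    rw [← pow_succ]
    exact Nat.pow_le_pow_right (by norm_num) (by nlinarith)
  calc 3 * m ^ e < 2 ^ 2 * 2 ^ ((c + 1) * L * 2 ^ (2 * L)) := by
        have : 0 < m ^ e := by positivity
        omega
    _ = 2 ^ (2 + (c + 1) * L * 2 ^ (2 * L)) := (pow_add _ _ _).symm
    _ ≤ _ := Nat.pow_le_pow_right (by norm_num) (by omega)

/-- For `n ≥ 2`, space `O(⌈n ^ 2 / α⌉ * (log n) ^ 4)` suffices for insertion-deletion streams. With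
`L = ⌈log₂ n⌉`, the parameters are chosen so that the failure probabilities compare with `2⁻ᴰᴸ`, the
inverse of the number of seeds, and `T = ⌈n ^ 2 / α⌉` edges are recovered. -/
lemma exists_insertionDeletion_streamAlg_of_two_le (q c : ℕ) :
    ∃ C : ℕ, ∀ n : ℕ, 2 ≤ n → ∀ α : ℝ, 1 ≤ α →
      ∃ s : ℕ, s ≤ C * ⌈(n : ℝ) ^ 2 / α⌉₊ * Nat.clog 2 n ^ 4 ∧
        ∃ A : StreamAlg (Bool × Sym2 (Fin n)) (List (Fin n)) s,
        ∀ (G : SimpleGraph (Fin n)) (l : List (Bool × Sym2 (Fin n))),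
          IsInsertionDeletionStream (n ^ c) G l →
            1 - ((n : ℝ≥0∞) ^ q)⁻¹ ≤ A.prob l {o | IsApproxLongestPath G α o} := by
  obtain ⟨D, hD⟩ : ∃ D, D = q + c + 4 := ⟨_, rfl⟩
  refine ⟨D + (c + 1) * ((D + 5) * ((c + 3) * (6 * D + 21) + (2 * D + 6))),
    fun n hn α hα => ?_⟩
  obtain ⟨L, hLdef⟩ : ∃ L, L = Nat.clog 2 n := ⟨_, rfl⟩
  have hL : 1 ≤ L := hLdef ▸ Nat.clog_pos (by norm_num) hn
  have hnL : n ≤ 2 ^ L := hLdef ▸ Nat.le_pow_clog (by norm_num) n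
  have : Nonempty (Fin n) := ⟨⟨0, by omega⟩⟩
  obtain ⟨T, hTdef⟩ : ∃ T, T = ⌈(n : ℝ) ^ 2 / α⌉₊ := ⟨_, rfl⟩
  have hT1 : 1 ≤ T := by
    rw [hTdef, Nat.one_le_ceil_iff]
    have : 0 < α := by linarith
    positivity
  have hTα : (n : ℝ) ^ 2 / α ≤ T := hTdef ▸ Nat.le_ceil _
  have hE : Fintype.card (Sym2 (Fin n)) ≤ 2 ^ (2 * L) := by
    refine (card_sym2_fin_le n).trans ?_
    rw [mul_comm, pow_mul]
    exact Nat.pow_le_pow_left hnL 2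
  have hM : n ^ c + 1 ≤ 2 ^ ((c + 1) * L) := by
    have h1 : n ^ c ≤ 2 ^ (c * L) := by
      rw [mul_comm, pow_mul]
      exact Nat.pow_le_pow_left hnL c
    have h2 : 1 ≤ 2 ^ (c * L) := Nat.one_le_two_pow
    have h3 : 2 ^ (c * L) * 2 ≤ 2 ^ ((c + 1) * L) := by
      rw [← pow_succ]
      exact Nat.pow_le_pow_right (by norm_num) (by nlinarith)
    omega
  obtain ⟨J, hJ⟩ : ∃ J, J = (D + 4) * L := ⟨_, rfl⟩
  obtain ⟨b, hb⟩ : ∃ b, b = (2 * D + 6) * L := ⟨_, rfl⟩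
  obtain ⟨K, hK⟩ : ∃ K, K = 3 * (T + b) := ⟨_, rfl⟩
  obtain ⟨r, hr⟩ : ∃ r, r = (c + 3) * L * K + b := ⟨_, rfl⟩
  have h3N : 3 * 2 ^ (D * L) ≤ 2 ^ (D * L + 2) := by
    rw [pow_add]; omega
  have hJb : J + (D * L + 2) ≤ b := by rw [hJ, hb]; nlinarith
  refine ⟨D * L + (c + 1) * L * ((J + 1) * r), ?_, ?_⟩
  · rw [← hTdef, ← hLdef]
    have hLT : L ≤ T * L := Nat.le_mul_of_pos_left L hT1
    have hTL : T ≤ T * L := Nat.le_mul_of_pos_right T hL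
    have hJ' : J + 1 ≤ (D + 5) * L := by rw [hJ]; nlinarith
    have hb' : b ≤ (2 * D + 6) * (T * L) := by
      rw [hb]; exact Nat.mul_le_mul_left _ hLT
    have hK' : K ≤ (6 * D + 21) * (T * L) := by
      rw [hK]; nlinarith
    have hr' : r ≤ ((c + 3) * (6 * D + 21) + (2 * D + 6)) * (T * L ^ 2) := by
      have hTL2 : T * L ≤ T * L ^ 2 :=
        Nat.mul_le_mul_left _ (Nat.le_self_pow two_ne_zero L)
      calc r ≤ (c + 3) * L * ((6 * D + 21) * (T * L)) + (2 * D + 6) * (T * L ^ 2) := by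
            rw [hr]
            exact Nat.add_le_add (Nat.mul_le_mul_left _ hK')
              (hb'.trans (Nat.mul_le_mul_left _ hTL2))
        _ = _ := by ring
    have hL4 : L ≤ T * L ^ 4 :=
      (Nat.le_self_pow (by norm_num) L).trans (Nat.le_mul_of_pos_left _ hT1)
    calc D * L + (c + 1) * L * ((J + 1) * r)
        ≤ D * (T * L ^ 4) + (c + 1) * L * (((D + 5) * L) *
          (((c + 3) * (6 * D + 21) + (2 * D + 6)) * (T * L ^ 2))) := by gcongr
      _ = _ := by ring
  · have hN : NeZero (2 ^ (D * L)) := ⟨by positivity⟩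
    have key := exists_insertionDeletion_streamAlg (n := n) (n ^ c) hα (T := T) (K := K) (J := J)
      (r := r) (b := b) (N := 2 ^ (D * L)) (t := 2 ^ ((c + 4) * L)) (p := n ^ q)
      (s := D * L + (c + 1) * L * ((J + 1) * r)) hTα hK.ge ?_ ?_ ?_ ?_ ?_ ?_ ?_
    · simpa using key
    · calc J * (3 * 2 ^ (D * L)) ≤ 2 ^ J * 2 ^ (D * L + 2) :=
            Nat.mul_le_mul Nat.lt_two_pow_self.le h3N
        _ = 2 ^ (J + (D * L + 2)) := (pow_add _ _ _).symm
        _ ≤ 2 ^ b := Nat.pow_le_pow_right (by norm_num) hJb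
    · calc Fintype.card (Sym2 (Fin n)) * (3 * 2 ^ (D * L)) ≤ 2 ^ (2 * L) * 2 ^ (D * L + 2) :=
            Nat.mul_le_mul hE h3N
        _ = 2 ^ (2 * L + (D * L + 2)) := (pow_add _ _ _).symm
        _ ≤ 2 ^ J := Nat.pow_le_pow_right (by norm_num) (by rw [hJ]; nlinarith)
    · calc (J + 1) * (Fintype.card (Sym2 (Fin n)) * (n ^ c + 1)) ^ K * (3 * 2 ^ (D * L))
          ≤ 2 ^ J * (2 ^ (2 * L) * 2 ^ ((c + 1) * L)) ^ K * 2 ^ (D * L + 2) := by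
            gcongr
            exact Nat.lt_two_pow_self
        _ = 2 ^ ((c + 3) * L * K + (J + (D * L + 2))) := by
            rw [← pow_add, ← pow_mul, ← pow_add, ← pow_add]
            congr 1
            ring
        _ ≤ 2 ^ r := Nat.pow_le_pow_right (by norm_num) (by omega)
    · exact three_mul_pow_lt_two_pow hL hM hE
    · positivity
    · calc 2 ^ ((c + 4) * L) * n ^ q ≤ 2 ^ ((c + 4) * L) * (2 ^ L) ^ q := by gcongr
        _ = 2 ^ (D * L) := by
            rw [← pow_mul, ← pow_add, hD]
            congr 1
            ring
    · calc 2 ^ (D * L) * (n ^ c + 1) ^ ((J + 1) * r)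
          ≤ 2 ^ (D * L) * (2 ^ ((c + 1) * L)) ^ ((J + 1) * r) := by gcongr
        _ = _ := by rw [← pow_mul, ← pow_add]

lemma exists_insertionDeletion_streamAlg_log (q c : ℕ) :
    ∃ (C : ℝ) (k : ℕ), ∀ (n : ℕ), 1 ≤ n → ∀ α : ℝ, 1 ≤ α →
      ∃ s : ℕ, (s : ℝ) ≤ C * max 1 ((n : ℝ) ^ 2 / α) * Real.log n ^ k ∧
      ∃ A : StreamAlg (Bool × Sym2 (Fin n)) (List (Fin n)) s,
        ∀ (G : SimpleGraph (Fin n)) (l : List (Bool × Sym2 (Fin n))),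
          IsInsertionDeletionStream (n ^ c) G l →
            1 - ((n : ℝ≥0∞) ^ q)⁻¹ ≤ A.prob l {o | IsApproxLongestPath G α o} := by
  obtain ⟨C, hC⟩ := exists_insertionDeletion_streamAlg_of_two_le q c
  refine ⟨C * 2 * 3 ^ 4, 4, fun n hn α hα => ?_⟩
  rcases hn.eq_or_lt with rfl | hn2
  · -- for `n = 1` the allowed error probability is `1`
    refine ⟨0, by simp, ⟨PMF.pure 0, fun m _ => PMF.pure m, fun _ => PMF.pure []⟩, ?_⟩
    simp
  · obtain ⟨s, hs, A, hA⟩ := hC n hn2 α hα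
    refine ⟨s, ?_, A, hA⟩
    have hT : (⌈(n : ℝ) ^ 2 / α⌉₊ : ℝ) ≤ 2 * max 1 ((n : ℝ) ^ 2 / α) := by
      have h1 := (Nat.ceil_lt_add_one (a := (n : ℝ) ^ 2 / α) (by positivity)).le
      have h2 := le_max_left 1 ((n : ℝ) ^ 2 / α)
      have h3 := le_max_right 1 ((n : ℝ) ^ 2 / α)
      linarith
    calc (s : ℝ) ≤ C * ⌈(n : ℝ) ^ 2 / α⌉₊ * (Nat.clog 2 n : ℝ) ^ 4 := by exact_mod_cast hs
      _ ≤ C * (2 * max 1 ((n : ℝ) ^ 2 / α)) * (3 * Real.log n) ^ 4 := by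
        gcongr
        exact natCast_clog_two_le hn2
      _ = _ := by ring

end Parameters

theorem corollary2 :
    -- insertion-only streams, error probability at most `1 / n ^ q`
    (∀ q : ℕ, ∃ (C : ℝ) (k : ℕ), ∀ (n : ℕ), 1 ≤ n → ∀ α : ℝ, 1 ≤ α →
      ∃ s : ℕ, (s : ℝ) ≤ C * max 1 ((n : ℝ) ^ 2 / α) * Real.log n ^ k ∧
      ∃ A : StreamAlg (Sym2 (Fin n)) (List (Fin n)) s,
        ∀ (G : SimpleGraph (Fin n)) (l : List (Sym2 (Fin n))), IsInsertionOnlyStream G l →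
          1 - ((n : ℝ≥0∞) ^ q)⁻¹ ≤ A.prob l {o | IsApproxLongestPath G α o}) ∧
    -- insertion-deletion streams with multiplicities at most `n ^ c`
    (∀ q c : ℕ, ∃ (C : ℝ) (k : ℕ), ∀ (n : ℕ), 1 ≤ n → ∀ α : ℝ, 1 ≤ α →
      ∃ s : ℕ, (s : ℝ) ≤ C * max 1 ((n : ℝ) ^ 2 / α) * Real.log n ^ k ∧
      ∃ A : StreamAlg (Bool × Sym2 (Fin n)) (List (Fin n)) s,
        ∀ (G : SimpleGraph (Fin n)) (l : List (Bool × Sym2 (Fin n))),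
          IsInsertionDeletionStream (n ^ c) G l →
            1 - ((n : ℝ≥0∞) ^ q)⁻¹ ≤ A.prob l {o | IsApproxLongestPath G α o}) := by
  refine ⟨fun q => ?_, exists_insertionDeletion_streamAlg_log⟩
  obtain ⟨C, k, h⟩ := exists_insertionDeletion_streamAlg_log q 0
  refine ⟨C, k, fun n hn α hα => ?_⟩
  obtain ⟨s, hs, A, hA⟩ := h n hn α hα
  obtain ⟨A', hA'⟩ := A.exists_prob_eq_map (Prod.mk true)
  refine ⟨s, hs, A', fun G l hl => ?_⟩
  rw [hA']
  exact hA G _ (by simpa using hl.isInsertionDeletionStream)
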